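/- Let $X$ be a locally convex Hausdorff topological vector space over $\mathbb{C}$. Call $X$ injective in the category $\mathcal{LCS}$ of locally convex Hausdorff topological vector spaces over $\mathbb{C}$ and continuous linear maps if, for every object $B$ of $\mathcal{LCS}$ and every linear subspace $A \subseteq B$ (with the subspace topology), each continuous linear map $f \colon A \to X$ extends to a continuous linear map $g \colon B \to X$. The following conditions are equivalent: (1) $X$ is an injective object of the category $\mathcal{LCS}$. (2) There are a set $T$, sets $J_{t_n}$ ($t \in T$, $n \in \omega$), and, for each $t \in T$, a complemented subspace $F_t$ of the product $\prod\{\ell_\infty(J_{t_n}) \colon n \in \omega\}$ (that is, a linear subspace which is the image of a continuous linear projection) such that $X$ is isomorphic, as a topological vector space, to the product $\prod\{F_t \colon t \in T\}$. Here $\ell_\infty(J)$ is the Banach space of bounded complex families indexed by $J$ with the supremum norm, and products carry the product topology. -/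

import Mathlib

universe u

open scoped ENNReal

/-- The complex Banach space `ℓ_∞(J)` of bounded families `(x_j)_{j ∈ J}` of complex numbers,
with the supremum norm. -/
abbrev EllInfty (J : Type u) : Type u := lp (fun _ : J => ℂ) ∞

/-- A complex topological vector space `X` is injective in the category of locally convex
Hausdorff complex topological vector spaces and continuous linear maps: every continuous linear
map into `X` defined on a (not necessarily closed) linear subspace `A`, with the subspace
topology, of a locally convex Hausdorff space `B` extends to a continuous linear map on `B`. -/
def IsInjectiveLCS (X : Type u) [AddCommGroup X] [Module ℂ X] [TopologicalSpace X] : Prop :=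
  ∀ (B : Type u) [AddCommGroup B] [Module ℂ B] [TopologicalSpace B] [IsTopologicalAddGroup B]
    [ContinuousSMul ℂ B] [LocallyConvexSpace ℝ B] [T2Space B]
    (A : Submodule ℂ B) (f : A →L[ℂ] X),
    ∃ g : B →L[ℂ] X, ∀ a : A, g (a : B) = f a

open Topology

/-! By Hahn–Banach each `ℓ_∞(J)` is injective, and injectivity passes to products and retracts; this
gives (2) ⇒ (1).

Conversely, `X` embeds in a product of spaces `ℓ_∞` indexed by its continuous seminorms, and
injectivity turns the embedding `s` into a retract with left inverse `r`. Each coordinate of the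
idempotent `P = s ∘ r` maps into a normed space, so it depends on finitely many coordinates. Closing
under these dependencies gives countable index sets, hence a well-ordered ranking with countable
fibres for which `P` is block triangular (`exists_rank_countable_fibers`). The range of such an
idempotent is the product of the ranges of its diagonal blocks, by transfinite recursion
(`IsTriangular.nonempty_equiv_pi_rankLayer`). Each factor is a retract of `X`, hence injective, and
lives on countably many coordinates, so it is complemented in a countable product. -/

open scoped Classical in
/-- The coordinate projection of a product that replaces the coordinates outside `s` by zero. -/
noncomputable def coordMask {R I : Type*} {E : I → Type*} [Semiring R] [∀ i, AddCommMonoid (E i)]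
    [∀ i, Module R (E i)] [∀ i, TopologicalSpace (E i)] (s : Set I) :
    (∀ i, E i) →L[R] (∀ i, E i) :=
  ContinuousLinearMap.pi fun i => if i ∈ s then ContinuousLinearMap.proj i else 0

section coordMask

variable {R I : Type*} {E : I → Type*} [Semiring R] [∀ i, AddCommMonoid (E i)]
  [∀ i, Module R (E i)] [∀ i, TopologicalSpace (E i)]

theorem coordMask_of_mem {s : Set I} {i : I} (hi : i ∈ s) (x : ∀ i, E i) :
    coordMask (R := R) s x i = x i := by
  simp [coordMask, hi]

theorem coordMask_of_notMem {s : Set I} {i : I} (hi : i ∉ s) (x : ∀ i, E i) :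
    coordMask (R := R) s x i = 0 := by
  simp [coordMask, hi]

end coordMask

/-- Given finite sets `N i` there is a well-ordered ranking with countable fibres that does not
increase from `i` to the members of `N i`. -/
theorem exists_rank_countable_fibers {I : Type*} (N : I → Finset I) :
    ∃ (_ : LinearOrder I) (_ : WellFoundedLT I) (ρ : I → I),
      (∀ a, {i | ρ i = a}.Countable) ∧ ∀ i, ∀ j ∈ N i, ρ j ≤ ρ i := by
  obtain ⟨_, hwf⟩ := exists_wellFoundedLT I
  let step : Set I → Set I := fun S => ⋃ a ∈ S, (N a : Set I)
  let A : I → Set I := fun i => ⋃ n : ℕ, step^[n] {i}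
  have hself (i : I) : i ∈ A i := Set.mem_iUnion.2 ⟨0, rfl⟩
  have hcount (i : I) : (A i).Countable := by
    refine Set.countable_iUnion fun n => ?_
    induction n with
    | zero => exact Set.countable_singleton i
    | succ n ih =>
      rw [Function.iterate_succ_apply']
      exact ih.biUnion fun a _ => (N a).countable_toSet
  have hclosed (a i j : I) (hi : i ∈ A a) (hj : j ∈ N i) : j ∈ A a := by
    obtain ⟨n, hn⟩ := Set.mem_iUnion.1 hi
    refine Set.mem_iUnion.2 ⟨n + 1, ?_⟩
    rw [Function.iterate_succ_apply']
    exact Set.mem_biUnion hn hj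
  -- The rank of `i` is the least `a` whose countable dependency closure `A a` contains `i`. That
  -- closure also contains `N i`, so members of `N i` have no larger rank.
  let ρ : I → I := fun i => wellFounded_lt.min {a | i ∈ A a} ⟨i, hself i⟩
  have hρ (i : I) : i ∈ A (ρ i) := wellFounded_lt.min_mem {a | i ∈ A a} ⟨i, hself i⟩
  refine ⟨_, hwf, ρ, fun a => (hcount a).mono ?_, fun i j hj => ?_⟩
  · rintro i rfl
    exact hρ i
  · exact not_lt.1 (wellFounded_lt.not_lt_min {a | j ∈ A a} (hclosed _ _ _ (hρ i) hj))

/-- A continuous linear map from a product into a normed space depends on finitely many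
coordinates only. -/
theorem ContinuousLinearMap.exists_finset_pi_eq_zero {𝕜 I F : Type*} {E : I → Type*}
    [NontriviallyNormedField 𝕜] [∀ i, AddCommGroup (E i)] [∀ i, Module 𝕜 (E i)]
    [∀ i, TopologicalSpace (E i)] [NormedAddCommGroup F] [NormedSpace 𝕜 F]
    (f : (∀ i, E i) →L[𝕜] F) :
    ∃ N : Finset I, ∀ x, (∀ i ∈ N, x i = 0) → f x = 0 := by
  have h : f ⁻¹' Metric.ball 0 1 ∈ 𝓝 (0 : ∀ i, E i) :=
    f.continuous.continuousAt.preimage_mem_nhds (by simpa using Metric.ball_mem_nhds (0 : F) one_pos)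
  rw [nhds_pi, Filter.mem_pi] at h
  obtain ⟨N, hN, t, ht, hsub⟩ := h
  refine ⟨hN.toFinset, fun x hx => ?_⟩
  -- The families vanishing on `N` form a subspace sent into the unit ball, so its image is zero.
  have hball (c : 𝕜) : ‖c‖ * ‖f x‖ < 1 := by
    have : c • x ∈ N.pi t := fun i hi => by
      simpa [hx i (hN.mem_toFinset.2 hi)] using mem_of_mem_nhds (ht i)
    simpa [norm_smul] using hsub this
  by_contra hne
  have hpos : 0 < ‖f x‖ := norm_pos_iff.2 hne
  obtain ⟨c, hc⟩ := NormedField.exists_lt_norm 𝕜 (‖f x‖⁻¹)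
  have := (inv_lt_iff_one_lt_mul₀ hpos).1 hc
  linarith [hball c]

/-! ### Triangular idempotents on products -/

section Triangular

variable {R I α : Type*} {E : I → Type*} [Ring R] [∀ i, AddCommGroup (E i)]
  [∀ i, Module R (E i)] [∀ i, TopologicalSpace (E i)]

/-- An operator on a product is triangular with respect to a ranking of the index set if each
coordinate of the value depends only on coordinates of at most the same rank. -/
def IsTriangular [LE α] (ρ : I → α) (P : (∀ i, E i) →L[R] (∀ i, E i)) : Prop :=
  ∀ i x, (∀ j, ρ j ≤ ρ i → x j = 0) → P x i = 0

theorem IsTriangular.congr [LE α] {ρ : I → α} {P : (∀ i, E i) →L[R] (∀ i, E i)}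
    (hP : IsTriangular ρ P) {i : I} {x y : ∀ i, E i} (h : ∀ j, ρ j ≤ ρ i → x j = y j) :
    P x i = P y i := by
  have := hP i (x - y) fun j hj => by simp [h j hj]
  rwa [map_sub, Pi.sub_apply, sub_eq_zero] at this

/-- The families supported in rank `a` whose coordinates of rank `a` are fixed by `P`. -/
def rankLayer (ρ : I → α) (P : (∀ i, E i) →L[R] (∀ i, E i)) (a : α) :
    Submodule R (∀ i, E i) where
  carrier := {y | (∀ i, ρ i ≠ a → y i = 0) ∧ ∀ i, ρ i = a → P y i = y i}
  zero_mem' := by simp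
  add_mem' := fun hx hy =>
    ⟨fun i hi => by simp [hx.1 i hi, hy.1 i hi], fun i hi => by simp [hx.2 i hi, hy.2 i hi]⟩
  smul_mem' := fun c x hx =>
    ⟨fun i hi => by simp [hx.1 i hi], fun i hi => by simp [hx.2 i hi]⟩

/-- The difference `w = z - P (z cut off below a)` is fixed by `P` and, by triangularity, vanishes
below rank `a`. Hence at rank `a` only its part of rank `a` contributes to `P w = w`. -/
theorem IsTriangular.mask_sub_mem_rankLayer [LinearOrder α] {ρ : I → α}
    {P : (∀ i, E i) →L[R] (∀ i, E i)} (hP : IsTriangular ρ P) (hPP : ∀ x, P (P x) = P x)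
    {z : ∀ i, E i} (hz : P z = z) (a : α) :
    coordMask (R := R) {j | ρ j = a} (z - P (coordMask (R := R) {j | ρ j < a} z)) ∈
      rankLayer ρ P a := by
  refine ⟨fun i hi => coordMask_of_notMem (by exact hi) _, ?_⟩
  rintro i rfl
  rw [coordMask_of_mem (by exact rfl)]
  set w := z - P (coordMask (R := R) {j | ρ j < ρ i} z) with hw
  have hPw : P w = w := by rw [hw, map_sub, hPP, hz]
  conv_rhs => rw [← hPw]
  refine hP.congr fun j hj => ?_
  rcases hj.lt_or_eq with hlt | heq
  · rw [coordMask_of_notMem (by exact hlt.ne), hw, Pi.sub_apply, eq_comm, sub_eq_zero]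
    conv_lhs => rw [← hz]
    exact hP.congr fun k hk => (coordMask_of_mem (by exact hk.trans_lt hlt) z).symm
  · exact coordMask_of_mem (by exact heq) _

variable [∀ i, IsTopologicalAddGroup (E i)]

open scoped Classical in
/-- The family with prescribed layers, built by recursion on the rank. -/
noncomputable def layerSum [LinearOrder α] [WellFoundedLT α] (ρ : I → α)
    (P : (∀ i, E i) →L[R] (∀ i, E i)) :
    (i : I) → (∀ a, rankLayer ρ P a) →L[R] E i :=
  (InvImage.wf ρ wellFounded_lt).fix fun i rec =>
    (ContinuousLinearMap.proj i).comp
      ((rankLayer ρ P (ρ i)).subtypeL.comp (ContinuousLinearMap.proj (ρ i))) +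
    (ContinuousLinearMap.proj i).comp
      (P.comp (ContinuousLinearMap.pi fun j => if h : ρ j < ρ i then rec j h else 0))

theorem layerSum_apply [LinearOrder α] [WellFoundedLT α] (ρ : I → α)
    (P : (∀ i, E i) →L[R] (∀ i, E i)) (y : ∀ a, rankLayer ρ P a) (i : I) :
    layerSum ρ P i y = (y (ρ i) : ∀ i, E i) i +
      P (coordMask (R := R) {j | ρ j < ρ i} fun j => layerSum ρ P j y) i := by
  have h : coordMask (R := R) {j | ρ j < ρ i} (fun j => layerSum ρ P j y) =
      fun j => if ρ j < ρ i then layerSum ρ P j y else 0 := by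
    ext j
    by_cases hj : ρ j < ρ i
    · rw [coordMask_of_mem (by exact hj), if_pos hj]
    · rw [coordMask_of_notMem (by exact hj), if_neg hj]
  rw [h]
  conv_lhs => rw [layerSum, WellFounded.fix_eq]
  simp only [add_apply, ContinuousLinearMap.comp_apply,
    ContinuousLinearMap.proj_apply, Submodule.subtypeL_apply]
  refine congrArg (fun z => (y (ρ i) : ∀ i, E i) i + P z i) (funext fun j => ?_)
  by_cases hj : ρ j < ρ i
  · simp [hj, layerSum]
  · simp [hj]

variable [LinearOrder α] [WellFoundedLT α] {ρ : I → α} {P : (∀ i, E i) →L[R] (∀ i, E i)}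

/-- Let `m` be the part of `x` below the rank of `i`. By induction `P m = P x = x` at lower ranks,
so up to this rank `x` agrees with `y (ρ i) + P m`, whose coordinate `i` is fixed by `P`. -/
theorem IsTriangular.apply_layerSum (hP : IsTriangular ρ P) (hPP : ∀ x, P (P x) = P x)
    (y : ∀ a, rankLayer ρ P a) :
    P (fun i => layerSum ρ P i y) = fun i => layerSum ρ P i y := by
  set x : ∀ i, E i := fun i => layerSum ρ P i y with hx
  ext i
  induction hi : ρ i using WellFoundedLT.induction generalizing i with
  | ind a ih =>
    subst hi
    set m : ∀ i, E i := coordMask (R := R) {j | ρ j < ρ i} x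
    have hxi : x i = (y (ρ i) : ∀ i, E i) i + P m i := layerSum_apply ρ P y i
    have hdec (j : I) (hj : ρ j ≤ ρ i) : x j = ((y (ρ i) : ∀ i, E i) + P m) j := by
      rcases hj.lt_or_eq with hlt | heq
      · rw [Pi.add_apply, (y (ρ i)).2.1 j hlt.ne, zero_add, ← ih _ hlt j rfl]
        exact hP.congr fun k hk => (coordMask_of_mem (by exact hk.trans_lt hlt) x).symm
      · have := layerSum_apply ρ P y j
        rwa [heq] at this
    rw [hP.congr hdec, map_add, hPP, Pi.add_apply, (y (ρ i)).2.2 i rfl, hxi]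

variable {X : Type*} [AddCommGroup X] [Module R X] [TopologicalSpace X]
  {s : X →L[R] (∀ i, E i)} {r : (∀ i, E i) →L[R] X}

/-- A retract of a product by a triangular idempotent is the product of the layers. -/
theorem IsTriangular.nonempty_equiv_pi_rankLayer (hrs : Function.LeftInverse r s)
    (hP : IsTriangular ρ (s.comp r)) :
    Nonempty (X ≃L[R] (∀ a, rankLayer ρ (s.comp r) a)) := by
  have hPP (x) : (s.comp r) ((s.comp r) x) = (s.comp r) x := by simp [hrs (r x)]
  have hs (x : X) : (s.comp r) (s x) = s x := by simp [hrs x]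
  let f (a : α) : X →L[R] (∀ i, E i) := (coordMask (R := R) {j | ρ j = a}).comp
    (s - (s.comp r).comp ((coordMask (R := R) {j | ρ j < a}).comp s))
  let Φ : X →L[R] (∀ a, rankLayer ρ (s.comp r) a) := ContinuousLinearMap.pi fun a =>
    (f a).codRestrict _ fun x => hP.mask_sub_mem_rankLayer hPP (hs x) a
  have hΦ (x : X) (i : I) : (Φ x (ρ i) : ∀ i, E i) i =
      s x i - (s.comp r) (coordMask (R := R) {j | ρ j < ρ i} (s x)) i :=
    coordMask_of_mem (by exact rfl) _
  let Ψ : (∀ a, rankLayer ρ (s.comp r) a) →L[R] X :=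
    r.comp (ContinuousLinearMap.pi (layerSum ρ (s.comp r)))
  have hsΨ (y) : s (Ψ y) = fun i => layerSum ρ (s.comp r) i y := hP.apply_layerSum hPP y
  have hΦΨ (y) : Φ (Ψ y) = y := by
    ext a i
    by_cases hi : ρ i = a
    · subst hi
      rw [hΦ, hsΨ, sub_eq_iff_eq_add]
      exact layerSum_apply ρ (s.comp r) y i
    · rw [(Φ (Ψ y) a).2.1 i hi, (y a).2.1 i hi]
  -- As `Φ ∘ Ψ = id`, injectivity makes `Ψ` a two-sided inverse. If `Φ x = 0`, then `s x` vanishes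
  -- rank by rank.
  have hinj : Function.Injective Φ := by
    refine (injective_iff_map_eq_zero Φ).2 fun x hx => ?_
    refine hrs.injective ?_
    rw [map_zero]
    ext i
    induction hi : ρ i using WellFoundedLT.induction generalizing i with
    | ind a ih =>
      subst hi
      have h := hΦ x i
      have hm : coordMask (R := R) {j | ρ j < ρ i} (s x) = 0 := by
        ext j
        by_cases hj : ρ j < ρ i
        · rw [coordMask_of_mem (by exact hj), ih _ hj j rfl]
        · rw [coordMask_of_notMem (by exact hj), Pi.zero_apply]
      rw [hm, hx, map_zero] at h
      exact (h.trans (sub_zero _)).symm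
  exact ⟨.equivOfInverse Φ Ψ (fun x => hinj (hΦΨ (Φ x))) hΦΨ⟩

end Triangular

/-! ### Injective spaces and spaces of bounded families -/

section Injective

variable {X : Type u} [AddCommGroup X] [Module ℂ X] [TopologicalSpace X]

open scoped ComplexOrder in
theorem LocallyConvexSpace.polynormableSpace_complex [IsTopologicalAddGroup X]
    [ContinuousSMul ℂ X] [LocallyConvexSpace ℝ X] : PolynormableSpace ℂ X := by
  have : ContinuousSMul ℝ X := IsScalarTower.continuousSMul ℂ
  have : LocallyConvexSpace ℂ X := .ofBases ℂ X (fun _ => id) (fun x s => s ∈ 𝓝 x ∧ Convex ℝ s)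
    LocallyConvexSpace.convex_basis fun _ _ hs => convex_of_nonneg_surjective_algebraMap _
      (fun z hz =>
        ⟨z.re, (Complex.nonneg_iff.1 hz).1, Complex.ext rfl (Complex.nonneg_iff.1 hz).2⟩)
      hs.2
  infer_instance

/-- Hahn–Banach is applied to each coordinate with one common dominating seminorm `q`, which keeps
the extended family bounded and the extension continuous. -/
theorem isInjectiveLCS_ellInfty (J : Type u) : IsInjectiveLCS (EllInfty J) := by
  intro B _ _ _ _ _ _ _ A f
  have : PolynormableSpace ℂ B := LocallyConvexSpace.polynormableSpace_complex
  obtain ⟨q, hq, hle⟩ := Seminorm.exists_le_comp_of_isInducing (f := A.subtype)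
    (p := (normSeminorm ℂ (EllInfty J)).comp f.toLinearMap) (by exact f.continuous.norm)
    IsInducing.subtypeVal
  have hbound (j : J) (a : A) : ‖(f a : J → ℂ) j‖ ≤ q a :=
    (lp.norm_apply_le_norm ENNReal.top_ne_zero (f a) j).trans (hle a)
  have hext (j : J) : ∃ g : Module.Dual ℂ B, (∀ a : A, g a = (f a : J → ℂ) j) ∧
      ∀ x, ‖g x‖ ≤ q x :=
    Module.Dual.exists_extension_of_le_seminorm A
      { toFun := fun a => (f a : J → ℂ) j
        map_add' := fun a b => by simp
        map_smul' := fun c a => by simp } (hbound j)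
  choose g hg hgq using hext
  let G : B →ₗ[ℂ] EllInfty J :=
    { toFun := fun x => ⟨fun j => g j x, memℓp_infty ⟨q x, by rintro _ ⟨j, rfl⟩; exact hgq j x⟩⟩
      map_add' := fun x y => by ext j; exact map_add (g j) x y
      map_smul' := fun c x => by ext j; exact map_smul (g j) c x }
  have hG (x : B) : ‖G x‖ ≤ q x :=
    lp.norm_le_of_forall_le (apply_nonneg q x) fun j => hgq j x
  have hcont : Continuous G :=
    (PolynormableSpace.withSeminorms ℂ B).continuous_normedSpace_rng _ G
      ⟨{⟨q, hq⟩}, 1, fun x => by simpa using hG x⟩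
  exact ⟨⟨G, hcont⟩, fun a => by ext j; exact hg j a⟩

/-- A retract of a product of injective spaces is injective. -/
theorem IsInjectiveLCS.of_hasLeftInverse_pi {I : Type*} {E : I → Type u}
    [∀ i, AddCommGroup (E i)] [∀ i, Module ℂ (E i)] [∀ i, TopologicalSpace (E i)]
    (hE : ∀ i, IsInjectiveLCS (E i)) {s : X →L[ℂ] (∀ i, E i)} (hs : s.HasLeftInverse) :
    IsInjectiveLCS X := by
  intro B _ _ _ _ _ _ _ A f
  obtain ⟨r, hr⟩ := hs
  choose g hg using fun i => hE i B A ((ContinuousLinearMap.proj i).comp (s.comp f))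
  refine ⟨r.comp (ContinuousLinearMap.pi g), fun a => ?_⟩
  have h : ContinuousLinearMap.pi g (a : B) = s (f a) := by
    ext i
    exact hg i a
  rw [ContinuousLinearMap.comp_apply, h, hr]

theorem IsInjectiveLCS.of_hasLeftInverse {Y : Type u} [AddCommGroup Y] [Module ℂ Y]
    [TopologicalSpace Y] (hY : IsInjectiveLCS Y) {s : X →L[ℂ] Y} (hs : s.HasLeftInverse) :
    IsInjectiveLCS X := by
  intro B _ _ _ _ _ _ _ A f
  obtain ⟨r, hr⟩ := hs
  obtain ⟨g, hg⟩ := hY B A (s.comp f)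
  exact ⟨r.comp g, fun a => by simp [hg, hr (f a)]⟩

variable [PolynormableSpace ℂ X]

/-- An injective space is a retract of every locally convex Hausdorff space it embeds in. -/
theorem IsInjectiveLCS.hasLeftInverse [T2Space X] (hX : IsInjectiveLCS X) {Y : Type u}
    [AddCommGroup Y] [Module ℂ Y] [TopologicalSpace Y] [PolynormableSpace ℂ Y] [T2Space Y] (f : X →L[ℂ] Y)
    (hf : ∀ p : Seminorm ℂ X, Continuous p →
      ∃ q : Seminorm ℂ Y, Continuous q ∧ p ≤ q.comp f.toLinearMap) :
    f.HasLeftInverse := by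
  have hY := PolynormableSpace.withSeminorms ℂ Y
  have := hY.topologicalAddGroup
  have := hY.continuousSMul
  have : LocallyConvexSpace ℝ Y := hY.toLocallyConvexSpace
  have hX' := PolynormableSpace.withSeminorms ℂ X
  have hinj : Function.Injective f.toLinearMap := by
    refine (injective_iff_map_eq_zero f.toLinearMap).2 fun x hx => ?_
    by_contra hne
    obtain ⟨p, hp⟩ := hX'.separating_of_T1 x hne
    obtain ⟨q, -, hle⟩ := hf p.1 p.2
    refine hp (le_antisymm ((hle x).trans ?_) (apply_nonneg _ x))
    rw [Seminorm.comp_apply, hx, map_zero]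
  let e := LinearEquiv.ofInjective f.toLinearMap hinj
  have he (a : f.toLinearMap.range) : f.toLinearMap (e.symm a) = a :=
    congrArg Subtype.val (e.apply_symm_apply a)
  have hcont : Continuous e.symm.toLinearMap := by
    refine hX'.continuous_of_continuous_comp _ fun p => ?_
    obtain ⟨q, hq, hle⟩ := hf p.1 p.2
    refine Seminorm.continuous_of_le (q := q.comp f.toLinearMap.range.subtype)
      (hq.comp continuous_subtype_val) fun a => (hle _).trans ?_
    simp only [Seminorm.comp_apply, LinearEquiv.coe_coe, he, Submodule.subtype_apply, le_refl]
  obtain ⟨g, hg⟩ := hX Y f.toLinearMap.range ⟨e.symm.toLinearMap, hcont⟩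
  exact ⟨g, fun x => (hg (e x)).trans (e.symm_apply_apply x)⟩

/-- The linear functionals dominated by a seminorm. -/
abbrev DominatedDual (p : Seminorm ℂ X) : Type u := {φ : Module.Dual ℂ X // ∀ x, ‖φ x‖ ≤ p x}

/-- The functionals dominated by `p`, evaluated at points of the space, as a continuous linear map
into a space of bounded families. -/
theorem exists_norm_eq_seminorm (p : Seminorm ℂ X) (hp : Continuous p) :
    ∃ f : X →L[ℂ] EllInfty (DominatedDual p), ∀ x, ‖f x‖ = p x := by
  let G : X →ₗ[ℂ] EllInfty (DominatedDual p) :=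
    { toFun := fun x =>
        ⟨fun φ => φ.1 x, memℓp_infty ⟨p x, by rintro _ ⟨φ, rfl⟩; exact φ.2 x⟩⟩
      map_add' := fun x y => by ext φ; exact map_add φ.1 x y
      map_smul' := fun c x => by ext φ; exact map_smul φ.1 c x }
  have hG (x : X) : ‖G x‖ ≤ p x :=
    lp.norm_le_of_forall_le (apply_nonneg p x) fun φ => φ.2 x
  have hcont : Continuous G :=
    (PolynormableSpace.withSeminorms ℂ X).continuous_normedSpace_rng _ G
      ⟨{⟨p, hp⟩}, 1, fun x => by simpa using hG x⟩
  refine ⟨⟨G, hcont⟩, fun x => (hG x).antisymm ?_⟩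
  by_cases hx : x = 0
  · simp [hx]
  -- Extending `c • x ↦ c * p x` from the line through `x` gives a dominated functional attaining `p
  -- x`.
  obtain ⟨g, hg, hgp⟩ := Module.Dual.exists_extension_of_le_seminorm (ℂ ∙ x)
    ((p x : ℂ) • (LinearEquiv.coord ℂ X x hx).toLinearMap) (p := p) fun y => by
      have : p y = ‖LinearEquiv.coord ℂ X x hx y‖ * p x := by
        rw [← map_smul_eq_mul, LinearEquiv.coord_apply_smul]
      simp [this, mul_comm, abs_of_nonneg (apply_nonneg p x)]
  have hgx : g x = p x := by
    refine (hg ⟨x, Submodule.mem_span_singleton_self x⟩).trans ?_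
    simp [LinearEquiv.coord_self]
  have := lp.norm_apply_le_norm ENNReal.top_ne_zero (G x) ⟨g, hgp⟩
  refine le_trans (le_of_eq ?_) this
  change p x = ‖g x‖
  rw [hgx, Complex.norm_real, Real.norm_of_nonneg (apply_nonneg p x)]

/-- Every injective space is a retract of a product of spaces of bounded families. -/
theorem IsInjectiveLCS.exists_retract_pi_ellInfty [T2Space X] (hX : IsInjectiveLCS X) :
    ∃ (I : Type u) (J : I → Type u) (s : X →L[ℂ] (∀ i, EllInfty (J i))), s.HasLeftInverse := by
  let I := {p : Seminorm ℂ X // Continuous p}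
  let E (p : I) := EllInfty (DominatedDual p.1)
  choose f hf using fun p : I => exists_norm_eq_seminorm p.1 p.2
  refine ⟨_, _, ContinuousLinearMap.pi f, hX.hasLeftInverse _ fun p hp => ?_⟩
  exact ⟨(normSeminorm ℂ _).comp (LinearMap.proj (R := ℂ) (φ := E) ⟨p, hp⟩),
    (continuous_apply (A := E) ⟨p, hp⟩).norm, fun x => (hf ⟨p, hp⟩ x).ge⟩

/-- An injective space that embeds in a countable product of spaces of bounded families is
isomorphic to a complemented subspace of a product of a sequence of such spaces. -/
theorem IsInjectiveLCS.exists_equiv_closedComplemented [T2Space X] (hX : IsInjectiveLCS X)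
    {J : ℕ → Type u} (f : X →L[ℂ] (∀ n, EllInfty (J n))) (hf : IsInducing f) :
    ∃ F : Submodule ℂ (∀ n, EllInfty (J n)), F.ClosedComplemented ∧ Nonempty (X ≃L[ℂ] F) := by
  have h : f.HasLeftInverse := hX.hasLeftInverse f fun p hp =>
    Seminorm.exists_le_comp_of_isInducing (f := f.toLinearMap) hp hf
  refine ⟨f.range, h.closedComplemented_range, ?_⟩
  obtain ⟨g, hg⟩ := h
  refine ⟨.equivOfInverse (f.codRestrict f.range fun x => ⟨x, rfl⟩) (g.comp f.range.subtypeL)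
    hg ?_⟩
  rintro ⟨_, x, rfl⟩
  exact Subtype.ext (congrArg f (hg x))

end Injective

/-- A subspace of families supported in a countable set of indices embeds in the product of a
sequence of factors. -/
theorem exists_isInducing_pi_nat {I : Type u} {J : I → Type u} {D : Set I} (hD : D.Countable)
    (K : Submodule ℂ (∀ i, EllInfty (J i))) (hK : ∀ y ∈ K, ∀ i ∉ D, y i = 0) :
    ∃ (J' : ℕ → Type u) (f : K →L[ℂ] (∀ n, EllInfty (J' n))), IsInducing f := by
  -- An empty `D` has no enumeration by `ℕ`, but then `K` is zero.
  rcases D.eq_empty_or_nonempty with rfl | hne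
  · have : Subsingleton K :=
      ⟨fun x y => by ext1; ext1 i; rw [hK x x.2 i id, hK y y.2 i id]⟩
    exact ⟨fun _ => PEmpty, 0, .of_subsingleton _⟩
  obtain ⟨e, rfl⟩ := hD.exists_eq_range hne
  let f : K →L[ℂ] (∀ n, EllInfty (J (e n))) :=
    (ContinuousLinearMap.pi fun n => ContinuousLinearMap.proj (e n)).comp K.subtypeL
  refine ⟨_, f, ⟨le_antisymm f.continuous.le_induced ?_⟩⟩
  refine continuous_iff_le_induced.1
    (@continuous_pi K I (fun i => EllInfty (J i)) (.induced f inferInstance) _ _ fun i => ?_)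
  by_cases hi : i ∈ Set.range e
  · obtain ⟨n, rfl⟩ := hi
    exact @Continuous.comp _ _ _ (.induced f inferInstance) _ _ _ _ (continuous_apply n)
      continuous_induced_dom
  · have h0 : (fun y : K => (y : ∀ i, EllInfty (J i)) i) = fun _ => 0 :=
      funext fun y => hK y y.2 i hi
    rw [h0]
    exact @continuous_const _ _ (.induced f inferInstance) _ 0

theorem theoremT (X : Type u) [AddCommGroup X] [Module ℂ X] [TopologicalSpace X]
    [IsTopologicalAddGroup X] [ContinuousSMul ℂ X] [LocallyConvexSpace ℝ X] [T2Space X] :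
    IsInjectiveLCS X ↔
      ∃ (T : Type u) (J : T → ℕ → Type u) (F : ∀ t : T, Submodule ℂ (∀ n : ℕ, EllInfty (J t n))),
        (∀ t : T, (F t).ClosedComplemented) ∧ Nonempty (X ≃L[ℂ] (∀ t : T, F t)) := by
  constructor
  · intro hX
    have : PolynormableSpace ℂ X := LocallyConvexSpace.polynormableSpace_complex
    obtain ⟨I, J, s, r, hrs⟩ := hX.exists_retract_pi_ellInfty
    choose N hN using fun i => ((ContinuousLinearMap.proj (R := ℂ)
      (φ := fun i => EllInfty (J i)) i).comp (s.comp r)).exists_finset_pi_eq_zero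
    obtain ⟨_, _, ρ, hcount, hρ⟩ := exists_rank_countable_fibers N
    have hP : IsTriangular ρ (s.comp r) := fun i x hx => hN i x fun j hj => hx j (hρ i j hj)
    obtain ⟨e⟩ := hP.nonempty_equiv_pi_rankLayer hrs
    -- A single factor is a retract of the whole product, hence of `X`.
    have hK (a : I) : IsInjectiveLCS (rankLayer ρ (s.comp r) a) := by
      classical
      refine hX.of_hasLeftInverse
        (s := e.symm.toContinuousLinearMap.comp 
          (ContinuousLinearMap.single ℂ (fun a => rankLayer ρ (s.comp r) a) a))
        ⟨(ContinuousLinearMap.proj a).comp e.toContinuousLinearMap, fun y => ?_⟩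
      simp
    have hF (a : I) : ∃ (J' : ℕ → Type u) (F : Submodule ℂ (∀ n, EllInfty (J' n))),
        F.ClosedComplemented ∧ Nonempty (rankLayer ρ (s.comp r) a ≃L[ℂ] F) := by
      obtain ⟨J', f, hf⟩ := exists_isInducing_pi_nat (hcount a) (rankLayer ρ (s.comp r) a)
        fun y hy i hi => hy.1 i hi
      exact ⟨J', (hK a).exists_equiv_closedComplemented f hf⟩
    choose J' F hF g using hF
    exact ⟨I, J', F, hF, ⟨e.trans (.piCongrRight fun a => (g a).some)⟩⟩
  · rintro ⟨T, J, F, hF, ⟨e⟩⟩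
    refine IsInjectiveLCS.of_hasLeftInverse_pi (fun t => ?_) e.hasLeftInverse
    obtain ⟨π, hπ⟩ := hF t
    exact IsInjectiveLCS.of_hasLeftInverse_pi (fun n => isInjectiveLCS_ellInfty (J t n))
      (s := (F t).subtypeL) ⟨π, hπ⟩
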